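/- Let $K$ be an infinite field (of arbitrary characteristic), let $m<n$ be positive integers, and set $d=\gcd(m,n)$. Let $T=(T_{ijk})_{1\le i\le m,\,1\le j\le n,\,1\le k\le 2}$ be an $m\times n\times 2$ array of independent indeterminates, $K[T]$ the polynomial ring in its entries, $X=(T_{ij1})_{i,j}$ and $Y=(T_{ij2})_{i,j}$. The group $G=\mathrm{SL}(m,K)\times \mathrm{SL}(n,K)$ acts on $K[T]$ by $K$-algebra automorphisms with $$(P,Q)\cdot X=P^{\top}XQ,\qquad (P,Q)\cdot Y=P^{\top}YQ ,$$ and $K[T]^G$ denotes the ring of invariants. Endow $K[T]$ with the degree lexicographic monomial order with $$T_{111}>T_{211}>\cdots>T_{m11}>T_{121}>\cdots>T_{m21}>\cdots>T_{mn1}>T_{112}>T_{212}>\cdots>T_{m12}>T_{122}>\cdots>T_{mn2}.$$ A subset $F$ of a $K$-subalgebra $A$ of $K[T]$ is called a sagbi basis of $A$ if the leading monomials of the nonzero elements of $F$ generate the $K$-algebra generated by the leading monomials of all nonzero elements of $A$. 1. Suppose $n=m+d$. Let $\Delta$ be the $(mn/d)\times(mn/d)$ determinant $$\Delta=\left|\begin{array}{ccccc}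 X\\ Y&X\\ &Y&\ddots\\ &&\ddots&X\\ &&&Y\end{array}\right|$$ with $n/d=m/d+1$ block rows of height $m$ and $m/d$ block columns of width $n$, in which the $q$-th block column has $X$ in block row $q$, $Y$ in block row $q+1$, and zeros elsewhere. Then $\{\Delta\}$ is a sagbi basis of $K[T]^G$. In particular, $K[T]^G=K[\Delta]$. 2. If $n\ne m+d$, then $K[T]^G=K$. -/

import Mathlib

open MvPolynomial Matrix

noncomputable section

namespace TensorInvariants

/-- Indices of the entries of an `m × n × 2` tensor of indeterminates; the entry `T i j k` has
index `(k, j, i)`, and indices are ordered lexicographically (first by `k`, then by `j`, then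
by `i`). -/
abbrev Idx (m n : ℕ) : Type := Fin 2 ×ₗ Fin n ×ₗ Fin m

/-- The polynomial ring `K[T]` in the entries of the `m × n × 2` tensor of indeterminates. -/
abbrev TensorRing (m n : ℕ) (K : Type*) [Field K] : Type _ := MvPolynomial (Idx m n) K

variable (m n : ℕ) (K : Type*) [Field K]

/-- The slice `(T i j k)_{i, j}` of the tensor of indeterminates: slice `0` is the matrix `X`
and slice `1` is the matrix `Y`. -/
def slice (k : Fin 2) : Matrix (Fin m) (Fin n) (TensorRing m n K) :=
  Matrix.of fun i j => MvPolynomial.X (toLex (k, toLex (j, i)))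

/-- A matrix over `K`, regarded as a matrix of constants over `K[T]`. -/
abbrev constMatrix {a b : Type} (M : Matrix a b K) : Matrix a b (TensorRing m n K) :=
  M.map (algebraMap K (TensorRing m n K))

/-- The `K`-algebra endomorphism of `K[T]` that sends the matrix `X` to `Pᵀ X Q` and the matrix
`Y` to `Pᵀ Y Q`. -/
def substHom (P : Matrix (Fin m) (Fin m) K) (Q : Matrix (Fin n) (Fin n) K) :
    TensorRing m n K →ₐ[K] TensorRing m n K :=
  MvPolynomial.aeval fun t : Idx m n =>
    ((constMatrix m n K P)ᵀ * slice m n K (ofLex t).1 * constMatrix m n K Q)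
      (ofLex (ofLex t).2).2 (ofLex (ofLex t).2).1

theorem map_slice (P : Matrix (Fin m) (Fin m) K) (Q : Matrix (Fin n) (Fin n) K) (k : Fin 2) :
    (slice m n K k).map (substHom m n K P Q) =
      (constMatrix m n K P)ᵀ * slice m n K k * constMatrix m n K Q := by
  ext1 i j
  exact MvPolynomial.aeval_X _ _

theorem algHom_map_constMatrix {a b : Type} (φ : TensorRing m n K →ₐ[K] TensorRing m n K)
    (M : Matrix a b K) : (constMatrix m n K M).map φ = constMatrix m n K M := by
  ext1 i j
  exact φ.commutes (M i j)

theorem algHom_ext_slice {φ ψ : TensorRing m n K →ₐ[K] TensorRing m n K}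
    (h : ∀ k, (slice m n K k).map φ = (slice m n K k).map ψ) : φ = ψ := by
  apply MvPolynomial.algHom_ext
  intro t
  exact congrFun (congrFun (h (ofLex t).1) (ofLex (ofLex t).2).2) (ofLex (ofLex t).2).1

theorem substHom_one : substHom m n K 1 1 = 1 := by
  apply algHom_ext_slice
  intro k
  rw [map_slice]
  simp only [constMatrix, Matrix.map_one _ (map_zero _) (map_one _), Matrix.transpose_one,
    Matrix.one_mul, Matrix.mul_one]
  rfl

theorem substHom_mul (P P' : Matrix (Fin m) (Fin m) K) (Q Q' : Matrix (Fin n) (Fin n) K) :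
    substHom m n K (P * P') (Q * Q') = substHom m n K P Q * substHom m n K P' Q' := by
  apply algHom_ext_slice
  intro k
  have hc : (slice m n K k).map
      (substHom m n K P Q * substHom m n K P' Q' : TensorRing m n K →ₐ[K] TensorRing m n K) =
      ((slice m n K k).map (substHom m n K P' Q')).map (substHom m n K P Q) := by
    ext1 i j
    simp only [Matrix.map_apply, AlgHom.mul_apply]
  rw [hc, map_slice, map_slice, Matrix.map_mul, Matrix.map_mul, Matrix.transpose_map,
    algHom_map_constMatrix, algHom_map_constMatrix, map_slice]
  simp only [constMatrix, Matrix.map_mul, Matrix.transpose_mul, Matrix.mul_assoc]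

/-- The action of `SL(m, K) × SL(n, K)` on `K[T]` by `K`-algebra endomorphisms, with
`(P, Q) • X = Pᵀ X Q` and `(P, Q) • Y = Pᵀ Y Q`. -/
def slAction :
    SpecialLinearGroup (Fin m) K × SpecialLinearGroup (Fin n) K →*
      (TensorRing m n K →ₐ[K] TensorRing m n K) where
  toFun g := substHom m n K g.1 g.2
  map_one' := substHom_one m n K
  map_mul' g h := substHom_mul m n K g.1 h.1 g.2 h.2

/-- The ring of invariants `K[T]^{SL(m, K) × SL(n, K)}`, as a `K`-subalgebra of `K[T]`. -/
def invariants : Subalgebra K (TensorRing m n K) where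
  carrier := {f | ∀ g, slAction m n K g f = f}
  mul_mem' ha hb g := by rw [map_mul, ha g, hb g]
  add_mem' ha hb g := by rw [map_add, ha g, hb g]
  algebraMap_mem' r g := (slAction m n K g).commutes r

/-- The block matrix with `t` block rows of height `m` and `s` block columns of width `n` that
has `X` in the blocks `(q, q)`, `Y` in the blocks `(q + 1, q)`, and zeros elsewhere. -/
def blockMatrix (t s : ℕ) : Matrix (Fin t × Fin m) (Fin s × Fin n) (TensorRing m n K) :=
  Matrix.of fun a b =>
    if (a.1 : ℕ) = b.1 then slice m n K 0 a.2 b.2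
    else if (a.1 : ℕ) = b.1 + 1 then slice m n K 1 a.2 b.2
    else 0

/-- The rows of the block matrix, numbered from top to bottom, block by block. -/
def rowEquiv : Fin (n / Nat.gcd m n) × Fin m ≃ Fin (m * n / Nat.gcd m n) :=
  finProdFinEquiv.trans <| finCongr <| by
    rw [mul_comm, Nat.mul_div_assoc _ (Nat.gcd_dvd_right m n)]

/-- The columns of the block matrix, numbered from left to right, block by block. -/
def colEquiv : Fin (m / Nat.gcd m n) × Fin n ≃ Fin (m * n / Nat.gcd m n) :=
  finProdFinEquiv.trans <| finCongr <| by
    rw [mul_comm m n, mul_comm, Nat.mul_div_assoc _ (Nat.gcd_dvd_left m n)]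

/-- The `(mn/d) × (mn/d)` block-bidiagonal determinant, where `d = gcd(m, n)`, with `n/d` block
rows of height `m` and `m/d` block columns of width `n`. -/
def blockDet : TensorRing m n K :=
  (Matrix.reindex (rowEquiv m n) (colEquiv m n)
    (blockMatrix m n K (n / Nat.gcd m n) (m / Nat.gcd m n))).det

variable {K} {σ : Type*}

/-- The leading monomial of a (nonzero) polynomial with respect to a monomial order. -/
def leadingMonomial (ord : MonomialOrder σ) (f : MvPolynomial σ K) : MvPolynomial σ K :=
  MvPolynomial.monomial (ord.degree f) 1

/-- The initial algebra of a subalgebra `A` of a polynomial ring: the subalgebra generated by the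
leading monomials of the nonzero elements of `A`. -/
def initialAlgebra (ord : MonomialOrder σ) (A : Subalgebra K (MvPolynomial σ K)) :
    Subalgebra K (MvPolynomial σ K) :=
  Algebra.adjoin K (leadingMonomial ord '' {f | f ∈ A ∧ f ≠ 0})

/-- `F` is a sagbi basis of the subalgebra `A`: it is a subset of `A`, and the leading monomials of
its nonzero elements generate the initial algebra of `A`. -/
def IsSagbiBasis (ord : MonomialOrder σ) (A : Subalgebra K (MvPolynomial σ K))
    (F : Set (MvPolynomial σ K)) : Prop :=
  F ⊆ A ∧ Algebra.adjoin K (leadingMonomial ord '' {f | f ∈ F ∧ f ≠ 0}) = initialAlgebra ord A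

/-- The degree lexicographic monomial order on `K[T]`, in which the variables are ordered by
`T 1 1 1 > T 2 1 1 > ⋯ > T m 1 1 > T 1 2 1 > ⋯ > T m n 1 > T 1 1 2 > ⋯ > T m n 2`. -/
def tensorOrder : MonomialOrder (Idx m n) := MonomialOrder.degLex

end TensorInvariants

end

/-!
The proof studies the orbit of one pencil, `C = ([I 0], [0 I])` of size `m × (m + e)`, called
`shiftPencil`.

The orbit of `C` under `GL × GL` is dense, in the sense that a polynomial vanishing on it is zero
(`eq_zero_of_eval_shiftPencil_orbit`). This rests on the surjectivity of the tangent map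
`(A, B) ↦ A C + C B` of the orbit (`exists_mul_shiftPencil_add_shiftPencil_mul`), which is proved by
solving the linear equations explicitly. It implies density in every characteristic: a nonzero
polynomial, expanded at `C`, has a lowest-degree component, which would vanish on all tangent
directions (`eq_zero_of_forall_curve_zero`).

An invariant of `SL × SL` that is homogeneous of degree `D` is a relative invariant of `GL × GL`
with weights `det P ^ (D / m)` and `det Q ^ (D / n)` (`eval_mul_eq_of_isHomogeneous`). Over a field
that is not algebraically closed this is obtained by comparing `diag(p, 1, …, 1)` with scalar
matrices and letting `p` vary. Hence such an invariant is determined by its value at `C`.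

* If `e ∤ m`, which means `n ≠ m + gcd(m, n)`, a torus that multiplies `C` by a scalar shows that
  this value is zero unless `D = 0` (`eval_shiftPencil_eq_zero`), so only constants are invariant.
* If `e ∣ m`, then `e = gcd(m, n)`, the block determinant `Δ` is a relative invariant that does not
  vanish at `C` (`eval_blockDet_shiftPencil_ne_zero`), and `m, n ∣ D` forces the weights of the
  invariant to be those of a power of `Δ`. So the invariant is a multiple of that power.

Finally, a single nonzero polynomial is a sagbi basis of the algebra it generates, for any monomial
order (`isSagbiBasis_singleton`).
-/

noncomputable section

namespace TensorInvariants

variable {K : Type*} [Field K]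

/-! ### Evaluation along polynomial curves -/

/-- The value of a polynomial along a polynomial curve is a polynomial in the parameter. -/
theorem eval_aeval_curve {σ : Type*} (w : σ → Polynomial K) (f : MvPolynomial σ K) (t : K) :
    (aeval w f).eval t = MvPolynomial.eval (fun i => (w i).eval t) f := by
  induction f using MvPolynomial.induction_on with
  | C a => simp
  | add p q hp hq => simp [hp, hq]
  | mul_X p i hp => simp [hp]

theorem exists_eval_ne_zero [Infinite K] {σ : Type*} {f : MvPolynomial σ K} (hf : f ≠ 0) :
    ∃ x, MvPolynomial.eval x f ≠ 0 := by
  by_contra! h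
  exact hf (MvPolynomial.funext fun x => by simp [h x])

theorem eval_smul_of_isHomogeneous {σ : Type*} {f : MvPolynomial σ K} {D : ℕ}
    (hf : f.IsHomogeneous D) (c : K) (x : σ → K) :
    MvPolynomial.eval (c • x) f = c ^ D * MvPolynomial.eval x f := by
  rw [MvPolynomial.eval_eq, MvPolynomial.eval_eq, Finset.mul_sum]
  refine Finset.sum_congr rfl fun d hd => ?_
  have h := hf (MvPolynomial.mem_support_iff.mp hd)
  rw [Finsupp.weight_apply, Finsupp.sum] at h
  simp only [Pi.smul_apply, smul_eq_mul, mul_pow, Finset.prod_mul_distrib, Finset.prod_pow_eq_pow_sum]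
  simp only [Pi.one_apply, mul_one, smul_eq_mul] at h
  rw [h]
  ring

/-- If for every direction `V` there is a curve `t ↦ t V + t² W` with this tangent on which `g`
vanishes outside finitely many parameters, then `g = 0`: the lowest-degree homogeneous component of
`g` would vanish at every `V`. -/
theorem eq_zero_of_forall_curve_zero [Infinite K] {σ : Type*} (g : MvPolynomial σ K)
    (h : ∀ V : σ → K, ∃ W : σ → K, ∃ u : Polynomial K, u ≠ 0 ∧
      ∀ t, u.eval t ≠ 0 → MvPolynomial.eval (fun i => t * V i + t ^ 2 * W i) g = 0) :
    g = 0 := by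
  by_contra hg
  have hex : ∃ r, homogeneousComponent r g ≠ 0 := by
    by_contra! h0
    exact hg (by rw [← sum_homogeneousComponent g]; simp [h0])
  classical
  let r := Nat.find hex
  obtain ⟨V, hV⟩ := exists_eval_ne_zero (Nat.find_spec hex)
  obtain ⟨W, u, hu, hW⟩ := h V
  -- `g (t V + t² W) = t ^ r H(t)` with `H 0` the value at `V` of the lowest component
  let w : σ → Polynomial K := fun i => Polynomial.C (V i) + Polynomial.X * Polynomial.C (W i)
  let H : Polynomial K := ∑ D ∈ Finset.range (g.totalDegree + 1),
    Polynomial.X ^ (D - r) * aeval w (homogeneousComponent D g)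
  have hH0 : H.eval 0 = MvPolynomial.eval V (homogeneousComponent r g) := by
    have hr : r ∈ Finset.range (g.totalDegree + 1) := by
      rw [Finset.mem_range, Nat.lt_succ_iff]
      by_contra! hlt
      exact Nat.find_spec hex (homogeneousComponent_eq_zero _ _ hlt)
    simp only [H, Polynomial.eval_finsetSum]
    rw [Finset.sum_eq_single_of_mem r hr]
    · simp [eval_aeval_curve, w]
    · intro D _ hD
      rcases lt_or_gt_of_ne hD with hD | hD
      · have : homogeneousComponent D g = 0 := by simpa using Nat.find_min hex hD
        simp [this]
      · simp [Nat.sub_ne_zero_of_lt hD]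
  have hH : Polynomial.X ^ r * H * u = 0 := by
    refine Polynomial.funext fun t => ?_
    by_cases ht : u.eval t = 0
    · simp [ht]
    · have key : (Polynomial.X ^ r * H).eval t = 0 := by
        rw [← hW t ht]
        have hv : (fun i => t * V i + t ^ 2 * W i) = t • fun i => (w i).eval t := by
          ext i; simp [w]; ring
        conv_rhs => rw [← sum_homogeneousComponent g]
        rw [map_sum]
        simp only [H, Finset.mul_sum, Polynomial.eval_finsetSum]
        refine Finset.sum_congr rfl fun D _ => ?_
        rw [hv, eval_smul_of_isHomogeneous (homogeneousComponent_isHomogeneous D g)]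
        by_cases hD : D < r
        · have : homogeneousComponent D g = 0 := by simpa using Nat.find_min hex hD
          simp [this]
        · simp only [Polynomial.eval_mul, Polynomial.eval_pow, Polynomial.eval_X,
            eval_aeval_curve]
          rw [← mul_assoc, ← pow_add, Nat.add_sub_cancel' (not_lt.mp hD)]
      rw [Polynomial.eval_mul, key]; simp
  have : H ≠ 0 := by
    intro h0
    rw [h0] at hH0
    exact hV (by simpa using hH0.symm)
  simp [this, hu] at hH

/-! ### Semi-invariance from invariance under the special linear group -/

/-- A function on matrices that is right invariant under `SL`, polynomial along the diagonal
matrices `diag(1, …, p, …, 1)` and homogeneous along scalar matrices is a power of the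
determinant. -/
theorem eq_det_pow_of_right_invariant [Infinite K] {ι : Type*} [Fintype ι] [DecidableEq ι] (i₀ : ι)
    (D : ℕ) (F : Matrix ι ι K → K)
    (hinv : ∀ M S : Matrix ι ι K, S.det = 1 → F (M * S) = F M)
    (hpoly : ∃ h : Polynomial K, ∀ p, F (diagonal (Function.update 1 i₀ p)) = h.eval p)
    (hscal : ∀ c : K, F (c • 1) = c ^ D * F 1) :
    (F 1 ≠ 0 → Fintype.card ι ∣ D) ∧
      ∀ M : Matrix ι ι K, M.det ≠ 0 → F M = M.det ^ (D / Fintype.card ι) * F 1 := by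
  obtain ⟨h, hh⟩ := hpoly
  have hdet : ∀ p : K, (diagonal (Function.update (1 : ι → K) i₀ p)).det = p := fun p => by
    rw [det_diagonal, Finset.prod_update_of_mem (Finset.mem_univ _)]; simp
  -- `M` differs from a matrix `diag(1, …, det M, …, 1)` by a factor of determinant one
  have hM : ∀ M : Matrix ι ι K, M.det ≠ 0 → F M = h.eval M.det := fun M hM => by
    rw [← hh]
    set E := diagonal (Function.update (1 : ι → K) i₀ M.det)
    have hE : IsUnit E.det := by rw [hdet]; exact hM.isUnit
    rw [← hinv E (E⁻¹ * M), ← mul_assoc, mul_nonsing_inv _ hE, one_mul]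
    rw [det_mul, det_nonsing_inv, Ring.inverse_eq_inv', hdet, inv_mul_cancel₀ hM]
  have hpos : 0 < Fintype.card ι := Fintype.card_pos_iff.mpr ⟨i₀⟩
  -- for `M = c • 1` the two descriptions of `F M` give `h (c ^ |ι|) = c ^ D F 1`
  have hexp : Polynomial.expand K (Fintype.card ι) h = Polynomial.C (F 1) * Polynomial.X ^ D := by
    have : Polynomial.X * Polynomial.expand K (Fintype.card ι) h =
        Polynomial.X * (Polynomial.C (F 1) * Polynomial.X ^ D) := by
      refine Polynomial.funext fun c => ?_
      by_cases hc : c = 0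
      · simp [hc]
      · have hd : (c • (1 : Matrix ι ι K)).det = c ^ Fintype.card ι := by simp
        have := hM (c • 1) (by rw [hd]; exact pow_ne_zero _ hc)
        rw [hscal, hd] at this
        rw [Polynomial.eval_mul, Polynomial.expand_eval, ← this, Polynomial.eval_mul,
          Polynomial.eval_mul, Polynomial.eval_C, Polynomial.eval_pow, Polynomial.eval_X,
          mul_comm (F 1)]
    exact mul_left_cancel₀ Polynomial.X_ne_zero this
  have hdvd : F 1 ≠ 0 → Fintype.card ι ∣ D := fun h1 => by
    by_contra hn
    have := congrArg (fun q => Polynomial.coeff q D) hexp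
    simp [Polynomial.coeff_expand hpos, hn] at this
    exact h1 this.symm
  refine ⟨hdvd, fun M hM' => ?_⟩
  rw [hM M hM']
  by_cases h1 : F 1 = 0
  · rw [h1] at hexp ⊢
    rw [map_zero, zero_mul, ← map_zero (Polynomial.expand K (Fintype.card ι))] at hexp
    rw [Polynomial.expand_injective hpos hexp]; simp
  · have : h = Polynomial.C (F 1) * Polynomial.X ^ (D / Fintype.card ι) := by
      apply Polynomial.expand_injective hpos
      rw [hexp]
      simp [← pow_mul, Nat.mul_div_cancel' (hdvd h1)]
    rw [this, Polynomial.eval_mul, Polynomial.eval_C, Polynomial.eval_pow, Polynomial.eval_X,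
      mul_comm]

/-! ### Matrix pencils as points -/

/-- The point of affine space whose coordinates are the entries of the pencil `(Z 0, Z 1)`. -/
def pencilPoint {m n : ℕ} (Z : Fin 2 → Matrix (Fin m) (Fin n) K) : Idx m n → K :=
  fun t => Z (ofLex t).1 (ofLex (ofLex t).2).2 (ofLex (ofLex t).2).1

theorem exists_pencilPoint_eq {K : Type*} [Field K] {m n : ℕ} (x : Idx m n → K) :
    ∃ Z : Fin 2 → Matrix (Fin m) (Fin n) K, pencilPoint Z = x :=
  ⟨fun k => of fun i j => x (toLex (k, toLex (j, i))), rfl⟩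

theorem map_eval_slice {m n : ℕ} (Z : Fin 2 → Matrix (Fin m) (Fin n) K) (k : Fin 2) :
    (slice m n K k).map (eval (pencilPoint Z)) = Z k := by
  ext i j
  simp [slice, pencilPoint]

theorem map_eval_constMatrix {m n : ℕ} {a b : Type} (x : Idx m n → K) (M : Matrix a b K) :
    (constMatrix m n K M).map (eval x) = M := by
  ext i j
  simp [constMatrix]

theorem eval_substHom {m n : ℕ} (P : Matrix (Fin m) (Fin m) K) (Q : Matrix (Fin n) (Fin n) K)
    (Z : Fin 2 → Matrix (Fin m) (Fin n) K) (f : TensorRing m n K) :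
    eval (pencilPoint Z) (substHom m n K P Q f) =
      eval (pencilPoint fun k => Pᵀ * Z k * Q) f := by
  have h : ((eval (pencilPoint Z)).comp (substHom m n K P Q : TensorRing m n K →+* _)) =
      eval (pencilPoint fun k => Pᵀ * Z k * Q) := by
    refine MvPolynomial.ringHom_ext (fun c => ?_) (fun t => ?_)
    · rw [RingHom.comp_apply, AlgHom.coe_toRingHom, ← MvPolynomial.algebraMap_eq,
        AlgHom.commutes, MvPolynomial.algebraMap_eq, eval_C, eval_C]
    · have hk : ((constMatrix m n K P)ᵀ * slice m n K (ofLex t).1 * constMatrix m n K Q).map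
          (eval (pencilPoint Z)) = Pᵀ * Z (ofLex t).1 * Q := by
        rw [Matrix.map_mul, Matrix.map_mul, map_eval_slice, map_eval_constMatrix, ← transpose_map,
          map_eval_constMatrix]
      rw [RingHom.comp_apply, AlgHom.coe_toRingHom, substHom, aeval_X, eval_X]
      exact congrFun (congrFun hk _) _
  exact congrFun (congrArg DFunLike.coe h) f

theorem eval_eq_of_mem_invariants {m n : ℕ} {f : TensorRing m n K} (hf : f ∈ invariants m n K)
    {P : Matrix (Fin m) (Fin m) K} {Q : Matrix (Fin n) (Fin n) K} (hP : P.det = 1) (hQ : Q.det = 1)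
    (Z : Fin 2 → Matrix (Fin m) (Fin n) K) :
    eval (pencilPoint fun k => Pᵀ * Z k * Q) f = eval (pencilPoint Z) f := by
  rw [← eval_substHom]
  exact congrArg _ (hf (⟨P, hP⟩, ⟨Q, hQ⟩))

theorem map_eval_one_add_X_smul {ι : Type*} [DecidableEq ι] (M : Matrix ι ι K) (t : K) :
    (1 + (Polynomial.X : Polynomial K) • M.map Polynomial.C).map (Polynomial.evalRingHom t) =
      1 + t • M := by
  ext i j
  by_cases h : i = j <;> simp [h] <;> ring

theorem eval_det_one_add_X_smul {ι : Type*} [Fintype ι] [DecidableEq ι] (M : Matrix ι ι K)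
    (t : K) : (1 + (Polynomial.X : Polynomial K) • M.map Polynomial.C).det.eval t =
      (1 + t • M).det := by
  rw [← map_eval_one_add_X_smul]
  exact RingHom.map_det (Polynomial.evalRingHom t) _

/-- Along a polynomial curve of pencils, `f` is a polynomial in the parameter. -/
theorem exists_eval_pencilPoint_eq {m n : ℕ} (f : TensorRing m n K)
    (W : Fin 2 → Matrix (Fin m) (Fin n) (Polynomial K)) :
    ∃ h : Polynomial K, ∀ p,
      eval (pencilPoint fun k => (W k).map (Polynomial.evalRingHom p)) f = h.eval p :=
  ⟨aeval (fun t => W (ofLex t).1 (ofLex (ofLex t).2).2 (ofLex (ofLex t).2).1) f, fun p => by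
    rw [eval_aeval_curve]; rfl⟩

theorem map_eval_diagonal_update {ι : Type*} [DecidableEq ι] (i₀ : ι) (p : K) :
    (diagonal (Function.update 1 i₀ Polynomial.X)).map (Polynomial.evalRingHom p) =
      diagonal (Function.update 1 i₀ p) := by
  rw [diagonal_map (map_zero _)]
  congr 1
  ext i
  rcases eq_or_ne i i₀ with rfl | h
  · simp
  · simp [h]

theorem map_eval_map_C {a b : Type*} (M : Matrix a b K) (p : K) :
    (M.map Polynomial.C).map (Polynomial.evalRingHom p) = M := by
  ext i j; simp

theorem pencilPoint_smul {m n : ℕ} (c : K) (Z : Fin 2 → Matrix (Fin m) (Fin n) K) :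
    (pencilPoint fun k => c • Z k) = c • pencilPoint Z := rfl

/-- A homogeneous invariant of degree `D` is a relative invariant of `GL × GL`, with exponents
`D / m` and `D / n`. -/
theorem eval_mul_eq_of_isHomogeneous [Infinite K] {m n : ℕ} (hm : 0 < m) (hn : 0 < n)
    {f : TensorRing m n K} (hf : f ∈ invariants m n K) {D : ℕ} (hD : f.IsHomogeneous D)
    {P : Matrix (Fin m) (Fin m) K} {Q : Matrix (Fin n) (Fin n) K} (hP : P.det ≠ 0) (hQ : Q.det ≠ 0)
    (Z : Fin 2 → Matrix (Fin m) (Fin n) K) :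
    (eval (pencilPoint Z) f ≠ 0 → m ∣ D ∧ n ∣ D) ∧
      eval (pencilPoint fun k => Pᵀ * Z k * Q) f =
        P.det ^ (D / m) * Q.det ^ (D / n) * eval (pencilPoint Z) f := by
  have left : ∀ Z : Fin 2 → Matrix (Fin m) (Fin n) K, _ := fun Z =>
    eq_det_pow_of_right_invariant (⟨0, hm⟩ : Fin m) D
      (fun M => eval (pencilPoint fun k => Mᵀ * Z k) f)
      (fun M S hS => by
        have := eval_eq_of_mem_invariants hf hS (det_one (n := Fin n)) fun k => Mᵀ * Z k
        simpa [transpose_mul, Matrix.mul_assoc] using this)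
      (by
        let W : Fin 2 → Matrix (Fin m) (Fin n) (Polynomial K) := fun k =>
          (diagonal (Function.update 1 (⟨0, hm⟩ : Fin m) Polynomial.X) :
            Matrix (Fin m) (Fin m) (Polynomial K)) * (Z k).map Polynomial.C
        obtain ⟨h, hh⟩ := exists_eval_pencilPoint_eq f W
        refine ⟨h, fun p => ?_⟩
        rw [← hh]
        simp only [W, Matrix.map_mul, map_eval_diagonal_update, map_eval_map_C, diagonal_transpose])
      (fun c => by
        simp only [transpose_smul, transpose_one, smul_mul, Matrix.one_mul, pencilPoint_smul]
        exact eval_smul_of_isHomogeneous hD c _)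
  have right : ∀ Z : Fin 2 → Matrix (Fin m) (Fin n) K, _ := fun Z =>
    eq_det_pow_of_right_invariant (⟨0, hn⟩ : Fin n) D
      (fun M => eval (pencilPoint fun k => Z k * M) f)
      (fun M S hS => by
        have := eval_eq_of_mem_invariants hf (det_one (n := Fin m)) hS fun k => Z k * M
        simpa [Matrix.mul_assoc] using this)
      (by
        let W : Fin 2 → Matrix (Fin m) (Fin n) (Polynomial K) := fun k =>
          (Z k).map Polynomial.C * (diagonal (Function.update 1 (⟨0, hn⟩ : Fin n) Polynomial.X) :
            Matrix (Fin n) (Fin n) (Polynomial K))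
        obtain ⟨h, hh⟩ := exists_eval_pencilPoint_eq f W
        refine ⟨h, fun p => ?_⟩
        rw [← hh]
        simp only [W, Matrix.map_mul, map_eval_diagonal_update, map_eval_map_C])
      (fun c => by
        simp only [Matrix.mul_smul, Matrix.mul_one, pencilPoint_smul]
        exact eval_smul_of_isHomogeneous hD c _)
  simp only [transpose_one, Matrix.one_mul, Matrix.mul_one, Fintype.card_fin] at left right
  refine ⟨fun h => ⟨(left Z).1 h, (right Z).1 h⟩, ?_⟩
  rw [(right fun k => Pᵀ * Z k).2 Q hQ, (left Z).2 P hP]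
  ring

theorem homogeneousComponent_mem_invariants {m n : ℕ} {f : TensorRing m n K}
    (hf : f ∈ invariants m n K) (D : ℕ) : homogeneousComponent D f ∈ invariants m n K := by
  intro g
  have hom : ∀ E, (slAction m n K g (homogeneousComponent E f)).IsHomogeneous E := fun E => by
    have := (homogeneousComponent_isHomogeneous E f).aeval (n := 1) (fun t : Idx m n =>
      ((constMatrix m n K (g.1 : Matrix (Fin m) (Fin m) K))ᵀ * slice m n K (ofLex t).1 *
        constMatrix m n K (g.2 : Matrix (Fin n) (Fin n) K))
      (ofLex (ofLex t).2).2 (ofLex (ofLex t).2).1) (fun t => by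
        rw [Matrix.mul_apply]
        refine IsHomogeneous.sum _ _ _ fun j _ => ?_
        rw [Matrix.mul_apply, Finset.sum_mul]
        refine IsHomogeneous.sum _ _ _ fun i _ => ?_
        exact ((isHomogeneous_C _ _).mul (isHomogeneous_X _ _)).mul (isHomogeneous_C _ _))
    rwa [one_mul] at this
  conv_rhs => rw [← hf g]
  conv_rhs => rw [← sum_homogeneousComponent f]
  rw [map_sum, map_sum]
  simp only [homogeneousComponent_of_mem (hom _)]
  rw [Finset.sum_ite_eq]
  split_ifs with h
  · rfl
  · rw [homogeneousComponent_eq_zero _ _ (by simpa [Nat.lt_succ_iff] using h), map_zero]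

/-! ### The generic pencil has an open orbit -/

/-- The pencil `([I 0], [0 I])` of size `m × n`, the second identity block being shifted by `e`
columns. For `n = m + e` it is a direct sum of `e` Kronecker blocks of nearly equal size, the
generic type. -/
def shiftPencil (K : Type*) [Field K] (m n e : ℕ) (k : Fin 2) : Matrix (Fin m) (Fin n) K :=
  of fun i j => if (j : ℕ) = i + k * e then 1 else 0

/-- A difference equation in the direction `(e, e)` is solvable with zero boundary values at columns
`≥ m` on and above the main diagonal, and at columns `< 0` below it: only one of the two conditions
concerns each line of that direction. -/
theorem exists_diagonal_difference_eq (m e : ℕ) (he : 0 < e) (W : ℤ → ℤ → K)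
    (hW : ∀ i j : ℤ, j < -e ∨ (m : ℤ) ≤ j → W i j = 0) :
    ∃ A : ℤ → ℤ → K, (∀ i j, -(e : ℤ) ≤ j → j < m → A i j - A (i + e) (j + e) = W i j) ∧
      (∀ i j, i ≤ j → (m : ℤ) ≤ j → A i j = 0) ∧ (∀ i j, j < i → j < 0 → A i j = 0) := by
  -- sum forwards on and above the diagonal, backwards below it; `N` steps leave the support
  let N : ℕ := m + 2
  have hN : (m : ℤ) + e ≤ N * e := by
    have : (1 : ℤ) ≤ e := by exact_mod_cast he
    simp only [N]; push_cast; nlinarith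
  refine ⟨fun i j => if i ≤ j then ∑ s ∈ Finset.range N, W (i + s * e) (j + s * e)
    else -∑ s ∈ Finset.range N, W (i - (s + 1) * e) (j - (s + 1) * e), ?_, ?_, ?_⟩
  · intro i j h1 h2
    by_cases hij : i ≤ j
    · simp only [hij, if_true, add_le_add_iff_right]
      have e1 := Finset.sum_range_succ (fun s : ℕ => W (i + s * e) (j + s * e)) N
      rw [Finset.sum_range_succ', hW (i + N * e) _ (Or.inr (by linarith))] at e1
      have e2 : ∀ s : ℕ, W (i + e + s * e) (j + e + s * e) =
          W (i + ((s + 1 : ℕ) : ℤ) * e) (j + ((s + 1 : ℕ) : ℤ) * e) := fun s => by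
        congr 1 <;> push_cast <;> ring
      simp only [e2]
      simp only [Nat.cast_zero, zero_mul, add_zero] at e1
      rw [← e1]; ring
    · simp only [hij, if_false, add_le_add_iff_right]
      have e1 := Finset.sum_range_succ (fun s : ℕ => W (i - s * e) (j - s * e)) N
      rw [Finset.sum_range_succ', hW (i - N * e) _ (Or.inl (by linarith))] at e1
      have e2 : ∀ s : ℕ, W (i + e - (s + 1) * e) (j + e - (s + 1) * e) =
          W (i - s * e) (j - s * e) := fun s => by
        congr 1 <;> ring
      simp only [e2]
      simp only [Nat.cast_zero, zero_mul, sub_zero, add_zero, Nat.cast_add, Nat.cast_one] at e1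
      rw [← e1]; ring
  · intro i j h1 h2
    simp only [h1, if_true]
    exact Finset.sum_eq_zero fun s _ => hW _ _ (Or.inr (by
      nlinarith [mul_nonneg (Int.natCast_nonneg s) (Int.natCast_nonneg e)]))
  · intro i j h1 h2
    simp only [not_le.mpr h1, if_false, neg_eq_zero]
    exact Finset.sum_eq_zero fun s _ => hW _ _ (Or.inl (by
      nlinarith [mul_nonneg (Int.natCast_nonneg s) (Int.natCast_nonneg e)]))

/-- The extension of a matrix by zero to all integer positions. -/
def extendZero {m n : ℕ} (M : Matrix (Fin m) (Fin n) K) (i j : ℤ) : K :=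
  if h : (0 ≤ i ∧ i < m) ∧ (0 ≤ j ∧ j < n) then
    M ⟨i.toNat, by omega⟩ ⟨j.toNat, by omega⟩ else 0

theorem extendZero_coe {m n : ℕ} (M : Matrix (Fin m) (Fin n) K) (i : Fin m) (j : Fin n) :
    extendZero M i j = M i j := by
  simp [extendZero]

theorem extendZero_eq_zero {m n : ℕ} (M : Matrix (Fin m) (Fin n) K) (i j : ℤ)
    (h : j < 0 ∨ (n : ℤ) ≤ j) : extendZero M i j = 0 :=
  dif_neg (by omega)

/-- The tangent map of the orbit of the generic pencil is surjective. -/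
theorem exists_mul_shiftPencil_add_shiftPencil_mul (m e : ℕ) (he : 0 < e)
    (V : Fin 2 → Matrix (Fin m) (Fin (m + e)) K) :
    ∃ (A : Matrix (Fin m) (Fin m) K) (B : Matrix (Fin (m + e)) (Fin (m + e)) K), ∀ k,
      A * shiftPencil K m (m + e) e k + shiftPencil K m (m + e) e k * B = V k := by
  -- the equation at `k = 0` determines the first `m` rows of `B` from `A`, the one at `k = 1` the
  -- rows from `e` on; the rows that are determined twice give a difference equation for `A`
  let v := fun k => extendZero (V k)
  obtain ⟨A, hA, hAr, hAl⟩ := exists_diagonal_difference_eq m e he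
    (fun i j => v 1 i (j + e) - v 0 (i + e) (j + e)) (fun i j h => by
      simp only [v]
      rw [extendZero_eq_zero, extendZero_eq_zero, sub_zero] <;> push_cast <;> omega)
  refine ⟨of fun i j => A i j, of fun i j => if (i : ℕ) < m then v 0 i j - A i j
    else v 1 (i - e) j - A (i - e) (j - e), fun k => ?_⟩
  ext i j
  -- the entries of `A` that fall outside the matrix are zero by the boundary conditions
  have hL : ((of fun i j : Fin m => A i j) * shiftPencil K m (m + e) e k) i j =
      A i (j - (k : ℕ) * e) := by
    simp only [Matrix.mul_apply, shiftPencil, of_apply, mul_ite, mul_one, mul_zero]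
    by_cases h : ∃ l : Fin m, (j : ℕ) = l + k * e
    · obtain ⟨l, hl⟩ := h
      rw [Finset.sum_eq_single l]
      · rw [if_pos hl]; congr 1; rw [hl]; push_cast; ring
      · intro l' _ hne
        exact if_neg fun h' => hne (Fin.ext (by omega))
      · simp
    · push Not at h
      rw [Finset.sum_eq_zero fun l _ => if_neg (h l)]
      symm
      have hi := i.2
      by_cases hj : (j : ℕ) < k * e
      · zify at hj
        exact hAl _ _ (by omega) (by omega)
      · have hj' : m ≤ j - k * e := by
          by_contra! hlt
          exact h ⟨j - k * e, hlt⟩ (by simp; omega)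
        have : (m : ℤ) ≤ j - (k : ℕ) * e := by zify [not_lt.mp hj] at hj'; exact hj'
        exact hAr _ _ (by omega) this
  have hk : (i : ℕ) + k * e < m + e := by
    fin_cases k
    · simp; omega
    · simp
  have hR : ∀ B : Matrix (Fin (m + e)) (Fin (m + e)) K,
      (shiftPencil K m (m + e) e k * B) i j = B ⟨i + k * e, hk⟩ j := fun B => by
    simp only [Matrix.mul_apply, shiftPencil, of_apply, ite_mul, one_mul, zero_mul]
    rw [Finset.sum_eq_single ⟨i + k * e, hk⟩]
    · simp
    · intro l _ hne
      exact if_neg fun h' => hne (Fin.ext h')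
    · simp
  rw [Matrix.add_apply, hL, hR]
  fin_cases k
  · simp [v, extendZero_coe]
  · by_cases h : (i : ℕ) + e < m
    · have := hA i (j - e) (by omega) (by omega)
      simp only [sub_add_cancel] at this
      simp [h, v]
      rw [← extendZero_coe (V 1)]
      simp only [v] at this
      linear_combination this
    · simp [h, v, extendZero_coe]

/-- A polynomial that vanishes on the `GL × GL`-orbit of the generic pencil is zero. The curve
`t ↦ (1 + t A) C (1 + t B)` in the orbit of `C` has tangent `A C + C B`, which is arbitrary, so
this follows from `eq_zero_of_forall_curve_zero`. -/
theorem eq_zero_of_eval_shiftPencil_orbit [Infinite K] (m e : ℕ) (he : 0 < e)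
    (g : TensorRing m (m + e) K)
    (hg : ∀ (P : Matrix (Fin m) (Fin m) K) (Q : Matrix (Fin (m + e)) (Fin (m + e)) K),
      P.det ≠ 0 → Q.det ≠ 0 →
        eval (pencilPoint fun k => Pᵀ * shiftPencil K m (m + e) e k * Q) g = 0) : g = 0 := by
  let c := pencilPoint (shiftPencil K m (m + e) e)
  let T : TensorRing m (m + e) K →ₐ[K] TensorRing m (m + e) K := aeval fun i => X i + C (c i)
  have hT : ∀ x, eval x (T g) = eval (fun i => x i + c i) g := fun x => by
    have := MvPolynomial.eval₂_comp_left (eval x) C (fun i => X i + C (c i)) g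
    simp only [T, aeval_def, algebraMap_eq]
    rw [this]
    have hC : (eval x).comp C = RingHom.id K := by ext; simp
    have hX : (eval x ∘ fun i => X i + C (c i)) = fun i => x i + c i := by ext; simp
    rw [hC, hX]
    rfl
  have hTg : T g = 0 := by
    refine eq_zero_of_forall_curve_zero _ fun x => ?_
    obtain ⟨V, rfl⟩ := exists_pencilPoint_eq x
    obtain ⟨A, B, hAB⟩ := exists_mul_shiftPencil_add_shiftPencil_mul m e he V
    refine ⟨pencilPoint fun k => A * shiftPencil K m (m + e) e k * B,
      (1 + (Polynomial.X : Polynomial K) • Aᵀ.map Polynomial.C).det *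
        (1 + (Polynomial.X : Polynomial K) • B.map Polynomial.C).det, ?_, fun t ht => ?_⟩
    · intro h0
      have := congrArg (Polynomial.eval 0) h0
      rw [Polynomial.eval_mul, eval_det_one_add_X_smul, eval_det_one_add_X_smul] at this
      simp at this
    · rw [Polynomial.eval_mul, eval_det_one_add_X_smul, eval_det_one_add_X_smul] at ht
      have key := hg (1 + t • Aᵀ) (1 + t • B) (left_ne_zero_of_mul ht) (right_ne_zero_of_mul ht)
      rw [hT]
      convert key using 3
      rw [← funext hAB]
      ext i
      simp only [c, pencilPoint, transpose_add, transpose_one, transpose_smul, transpose_transpose,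
        Matrix.add_mul, Matrix.mul_add, Matrix.one_mul, Matrix.mul_one, smul_mul, Matrix.mul_smul,
        Matrix.add_apply, Matrix.smul_apply, smul_eq_mul]
      ring
  by_contra hne
  obtain ⟨x, hx⟩ := exists_eval_ne_zero hne
  refine hx ?_
  have := hT (x - c)
  rw [hTg] at this
  simpa using this.symm

/-! ### The block determinant -/

open scoped Kronecker in
theorem map_substHom_blockMatrix {m n : ℕ} (t s : ℕ) (P : Matrix (Fin m) (Fin m) K)
    (Q : Matrix (Fin n) (Fin n) K) :
    (blockMatrix m n K t s).map (substHom m n K P Q) =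
      ((1 : Matrix (Fin t) (Fin t) (TensorRing m n K)) ⊗ₖ (constMatrix m n K P)ᵀ) *
        blockMatrix m n K t s *
        ((1 : Matrix (Fin s) (Fin s) (TensorRing m n K)) ⊗ₖ constMatrix m n K Q) := by
  ext1 ⟨q, i⟩ ⟨p, j⟩
  have hs : ∀ k, substHom m n K P Q (slice m n K k i j) =
      ((constMatrix m n K P)ᵀ * slice m n K k * constMatrix m n K Q) i j := fun k =>
    congrFun (congrFun (map_slice m n K P Q k) i) j
  have hR : (((1 : Matrix (Fin t) (Fin t) (TensorRing m n K)) ⊗ₖ (constMatrix m n K P)ᵀ) *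
        blockMatrix m n K t s *
        ((1 : Matrix (Fin s) (Fin s) (TensorRing m n K)) ⊗ₖ constMatrix m n K Q)) (q, i) (p, j) =
      ((constMatrix m n K P)ᵀ * (of fun i j => blockMatrix m n K t s (q, i) (p, j)) *
        constMatrix m n K Q) i j := by
    simp only [Matrix.mul_apply, Fintype.sum_prod_type, kroneckerMap_apply, one_apply, of_apply,
      ite_mul, mul_ite, one_mul, zero_mul, mul_zero, Finset.sum_ite_irrel,
      Finset.sum_const_zero, Finset.sum_ite_eq, Finset.sum_ite_eq', Finset.mem_univ, if_true]
  have hb : (of fun i j => blockMatrix m n K t s (q, i) (p, j)) =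
      if (q : ℕ) = p then slice m n K 0 else if (q : ℕ) = p + 1 then slice m n K 1 else 0 := by
    ext1 i j
    simp only [blockMatrix, of_apply]
    split_ifs <;> rfl
  rw [hR, hb, Matrix.map_apply, blockMatrix, of_apply]
  split_ifs
  · exact hs 0
  · exact hs 1
  · simp

/-- The block determinant is a relative invariant of `GL × GL`: the action multiplies the block
matrix by `1 ⊗ Pᵀ` on the left and by `1 ⊗ Q` on the right. -/
theorem substHom_blockDet {m n : ℕ} (P : Matrix (Fin m) (Fin m) K)
    (Q : Matrix (Fin n) (Fin n) K) :
    substHom m n K P Q (blockDet m n K) =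
      C (P.det ^ (n / Nat.gcd m n) * Q.det ^ (m / Nat.gcd m n)) * blockDet m n K := by
  have hdet : ∀ {l : ℕ} (M : Matrix (Fin l) (Fin l) K), (constMatrix m n K M).det = C M.det :=
    fun M => (RingHom.map_det (C : K →+* TensorRing m n K) M).symm
  have hmul : ∀ {a b c : Type} [Fintype a] [Fintype b] [Fintype c] [DecidableEq a] [DecidableEq b]
      [DecidableEq c] (e₁ : a ≃ c) (e₂ : b ≃ c) (A : Matrix a a (TensorRing m n K))
      (M : Matrix a b (TensorRing m n K)) (B : Matrix b b (TensorRing m n K)),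
      (reindex e₁ e₂ (A * M * B)).det = A.det * (reindex e₁ e₂ M).det * B.det := by
    intro a b c _ _ _ _ _ _ e₁ e₂ A M B
    rw [← det_reindex_self e₁ A, ← det_reindex_self e₂ B, ← det_mul, ← det_mul]
    simp only [reindex_apply, submatrix_mul_equiv]
  have hmap := AlgHom.map_det (substHom m n K P Q)
    (reindex (rowEquiv m n) (colEquiv m n)
      (blockMatrix m n K (n / Nat.gcd m n) (m / Nat.gcd m n)))
  rw [blockDet, hmap]
  have : (substHom m n K P Q).mapMatrix (reindex (rowEquiv m n) (colEquiv m n)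
      (blockMatrix m n K (n / Nat.gcd m n) (m / Nat.gcd m n))) =
      reindex (rowEquiv m n) (colEquiv m n)
        ((blockMatrix m n K (n / Nat.gcd m n) (m / Nat.gcd m n)).map (substHom m n K P Q)) := rfl
  rw [this, map_substHom_blockMatrix, hmul, det_kronecker, det_kronecker, det_transpose, hdet,
    hdet]
  simp only [det_one, one_pow, one_mul, Fintype.card_fin, map_mul, map_pow]
  ring

theorem blockDet_mem_invariants (m n : ℕ) : blockDet m n K ∈ invariants m n K := by
  rintro ⟨P, Q⟩
  have := substHom_blockDet (P : Matrix (Fin m) (Fin m) K) (Q : Matrix (Fin n) (Fin n) K)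
  rw [P.det_coe, Q.det_coe, one_pow, one_pow, one_mul, C_1, one_mul] at this
  exact this

theorem eval_blockDet_mul {m n : ℕ} (P : Matrix (Fin m) (Fin m) K)
    (Q : Matrix (Fin n) (Fin n) K) (Z : Fin 2 → Matrix (Fin m) (Fin n) K) :
    eval (pencilPoint fun k => Pᵀ * Z k * Q) (blockDet m n K) =
      P.det ^ (n / Nat.gcd m n) * Q.det ^ (m / Nat.gcd m n) *
        eval (pencilPoint Z) (blockDet m n K) := by
  rw [← eval_substHom, substHom_blockDet, map_mul, eval_C]

/-- The equations of the kernel of the block matrix of `shiftPencil`, where `v q i` is entry `i` of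
block `q`. Along each diagonal of fixed `i + q * d` they only link consecutive entries, up to sign.
If `i + q * d < m` the diagonal ends in block `0`, where `v` vanishes; otherwise it ends beyond the
last block. -/
theorem eq_zero_of_shift_recursion (m d s : ℕ) (hm : m = s * d) (v : ℕ → ℕ → K)
    (hs : ∀ i, v s i = 0) (h0 : ∀ i < m, v 0 i = 0)
    (h : ∀ q < s, ∀ i < m, v (q + 1) i + v q (i + d) = 0) (q i : ℕ) (hq : q < s)
    (hi : i < m + d) : v q i = 0 := by
  rcases lt_or_ge (i + q * d) m with hlt | hge
  · induction q generalizing i with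
    | zero => exact h0 i (by omega)
    | succ q ih =>
      rw [Nat.succ_mul] at hlt
      have h1 := h q (by omega) i (by omega)
      rwa [ih (i + d) (by omega) (by omega) (by omega), add_zero] at h1
  · obtain ⟨r, hr⟩ : ∃ r, s = q + r + 1 := ⟨s - q - 1, by omega⟩
    induction r generalizing q i with
    | zero =>
      have hd : d ≤ i := by
        rw [hm, hr, add_zero, Nat.succ_mul] at hge; omega
      have h1 := h q hq (i - d) (by omega)
      rwa [Nat.sub_add_cancel hd, show q + 1 = s by omega, hs, zero_add] at h1
    | succ r ih =>
      have hd : d ≤ i := by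
        have : m = q * d + r * d + d + d := by rw [hm, hr]; ring
        omega
      have h1 := h q hq (i - d) (by omega)
      rwa [Nat.sub_add_cancel hd, ih (q + 1) (i - d) (by omega) (by omega)
        (by rw [Nat.succ_mul]; omega) (by omega), zero_add] at h1

/-- The numerical block matrix of the generic pencil has trivial kernel. -/
theorem eq_zero_of_blockMatrix_mulVec_eq_zero (m d s : ℕ) (hm : m = s * d)
    (v : Fin s × Fin (m + d) → K)
    (hv : (blockMatrix m (m + d) K (s + 1) s).map
      (eval (pencilPoint (shiftPencil K m (m + d) d))) *ᵥ v = 0) : v = 0 := by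
  -- extended by zero, `v` satisfies the equation of row `(q, i)` also for `q = s`
  let w : ℕ → ℕ → K := fun q i =>
    if h : q < s ∧ i < m + d then v (⟨q, h.1⟩, ⟨i, h.2⟩) else 0
  have key : ∀ q < s + 1, ∀ i < m,
      (w q i) + (if 1 ≤ q then w (q - 1) (i + d) else 0) = 0 := by
    intro q hq i hi
    have hrow := congrFun hv (⟨q, hq⟩, ⟨i, hi⟩)
    have hpick : ∀ a b : ℕ,
        ∑ x : Fin s × Fin (m + d), (if a = x.1 ∧ b = x.2 then v x else 0) = w a b := by
      intro a b
      by_cases hab : a < s ∧ b < m + d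
      · rw [Finset.sum_eq_single (⟨a, hab.1⟩, ⟨b, hab.2⟩)]
        · simp [w, hab]
        · rintro ⟨a', b'⟩ _ hne
          exact if_neg fun h => hne (Prod.ext (Fin.ext h.1.symm) (Fin.ext h.2.symm))
        · simp
      · rw [Finset.sum_eq_zero fun x _ => if_neg fun h : a = x.1 ∧ b = x.2 =>
          hab ⟨h.1 ▸ x.1.2, h.2 ▸ x.2.2⟩]
        simp [w, hab]
    rw [← hpick q i, ← hpick (q - 1) (i + d)]
    refine Eq.trans ?_ hrow
    have hent : ∀ k (j : Fin (m + d)), eval (pencilPoint (shiftPencil K m (m + d) d))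
        (slice m (m + d) K k ⟨i, hi⟩ j) = if (j : ℕ) = i + k * d then 1 else 0 := fun k j =>
      congrFun (congrFun (map_eval_slice (shiftPencil K m (m + d) d) k) ⟨i, hi⟩) j
    rw [mulVec, dotProduct]
    by_cases h1 : 1 ≤ q
    · rw [if_pos h1, ← Finset.sum_add_distrib]
      refine Finset.sum_congr rfl fun x _ => ?_
      simp only [Matrix.map_apply, blockMatrix, of_apply, apply_ite (eval _), hent, map_zero]
      grind
    · rw [if_neg h1, add_zero]
      refine Finset.sum_congr rfl fun x _ => ?_
      simp only [Matrix.map_apply, blockMatrix, of_apply, apply_ite (eval _), hent, map_zero]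
      grind
  have hw : ∀ q < s, ∀ i < m + d, w q i = 0 := fun q hq i hi =>
    eq_zero_of_shift_recursion m d s hm w (fun i => dif_neg (by omega))
      (fun i hi => by simpa using key 0 (by omega) i hi)
      (fun q hq i hi => by simpa using key (q + 1) (by omega) i hi) q i hq hi
  ext ⟨q, i⟩
  simpa [w] using hw q q.2 i i.2

theorem eval_blockDet_shiftPencil_ne_zero (m d s : ℕ) (hd : 0 < d) (hm : m = s * d) :
    eval (pencilPoint (shiftPencil K m (m + d) d)) (blockDet m (m + d) K) ≠ 0 := by
  have hg : Nat.gcd m (m + d) = d := by simp [hm]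
  have hs : m / Nat.gcd m (m + d) = s := by rw [hg, hm, Nat.mul_div_cancel _ hd]
  have ht : (m + d) / Nat.gcd m (m + d) = s + 1 := by
    rw [hg, Nat.add_div_right _ hd, hm, Nat.mul_div_cancel _ hd]
  intro h
  have key : ∀ v : Fin (m / Nat.gcd m (m + d)) × Fin (m + d) → K,
      (blockMatrix m (m + d) K ((m + d) / Nat.gcd m (m + d)) (m / Nat.gcd m (m + d))).map
        (eval (pencilPoint (shiftPencil K m (m + d) d))) *ᵥ v = 0 → v = 0 := by
    rw [hs, ht]
    exact eq_zero_of_blockMatrix_mulVec_eq_zero m d s hm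
  rw [blockDet, RingHom.map_det, ← exists_mulVec_eq_zero_iff] at h
  obtain ⟨v, hv, h⟩ := h
  apply hv
  have h2 := key (v ∘ colEquiv m (m + d)) (by
    have h3 := (submatrix_mulVec_equiv
      ((blockMatrix m (m + d) K ((m + d) / Nat.gcd m (m + d)) (m / Nat.gcd m (m + d))).map
        (eval (pencilPoint (shiftPencil K m (m + d) d)))) v (rowEquiv m (m + d)).symm
        (colEquiv m (m + d)).symm).symm.trans h
    ext x
    have := congrFun h3 (rowEquiv m (m + d) x)
    simpa using this)
  ext x
  simpa using congrFun h2 ((colEquiv m (m + d)).symm x)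

/-! ### Invariants of positive degree -/

/-- If `e ∤ m`, homogeneous invariants of positive degree vanish at the generic pencil: a
one-parameter torus in `GL × GL` multiplies the pencil by `t`, hence the value of the invariant by
`t ^ D`, while the determinant weights of the torus give a different power of `t`. -/
theorem eval_shiftPencil_eq_zero [Infinite K] {m e : ℕ} (hm : 0 < m) (he : 0 < e) (hdvd : ¬ e ∣ m)
    {f : TensorRing m (m + e) K} (hf : f ∈ invariants m (m + e) K) {D : ℕ} (hD0 : D ≠ 0)
    (hD : f.IsHomogeneous D) : eval (pencilPoint (shiftPencil K m (m + e) e)) f = 0 := by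
  by_contra hne
  -- row `i` and columns `i`, `i + e` carry the nonzero entries; exactly one of the row and the
  -- column through such an entry is scaled by `t`
  let p : K → ℕ → K := fun t i => if e ∣ i then t else 1
  let q : K → ℕ → K := fun t j => if e ∣ j then 1 else t
  let a := ((Finset.range m).filter fun i => e ∣ i).card
  let b := ((Finset.range m).filter fun i => ¬ e ∣ i).card
  have hab : a + b = m := by
    simpa using Finset.card_filter_add_card_filter_not (s := Finset.range m) (fun i => e ∣ i)
  have hP : ∀ t, (diagonal fun i : Fin m => p t i).det = t ^ a := fun t => by
    rw [det_diagonal, Fin.prod_univ_eq_prod_range (p t) m]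
    simp [p, Finset.prod_ite, a]
  have hQ : ∀ t, (diagonal fun j : Fin (m + e) => q t j).det = t ^ (e - 1 + b) := fun t => by
    rw [det_diagonal, Fin.prod_univ_eq_prod_range (q t) (m + e), add_comm m e,
      Finset.prod_range_add, pow_add]
    congr 1
    · obtain ⟨e', rfl⟩ := Nat.exists_eq_succ_of_ne_zero he.ne'
      rw [Finset.prod_range_succ']
      have : ∀ i ∈ Finset.range e', q t (i + 1) = t := fun i hi =>
        if_neg fun h => by
          have := Nat.le_of_dvd (Nat.succ_pos i) h
          have := Finset.mem_range.mp hi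
          omega
      rw [Finset.prod_congr rfl this]
      simp [q]
    · simp [q, Finset.prod_ite, b]
  have hfix : ∀ t k, (diagonal fun i : Fin m => p t i)ᵀ * shiftPencil K m (m + e) e k *
      (diagonal fun j : Fin (m + e) => q t j) = t • shiftPencil K m (m + e) e k := by
    intro t k
    ext i j
    rw [diagonal_transpose, mul_diagonal, diagonal_mul]
    by_cases h : (j : ℕ) = i + k * e
    · have hd : e ∣ (j : ℕ) ↔ e ∣ (i : ℕ) := by
        rw [h, Nat.dvd_add_left (Dvd.intro_left _ rfl)]
      simp only [p, q, hd, shiftPencil, of_apply, if_pos h, Matrix.smul_apply, smul_eq_mul]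
      by_cases hi : e ∣ (i : ℕ) <;> simp [hi]
    · simp [shiftPencil, h]
  have hrel : ∀ t : K, t ≠ 0 → t ^ (a * (D / m) + (e - 1 + b) * (D / (m + e))) = t ^ D := by
    intro t ht
    have h1 := (eval_mul_eq_of_isHomogeneous hm (by omega) hf hD (by rw [hP t]; exact pow_ne_zero _ ht)
      (by rw [hQ t]; exact pow_ne_zero _ ht) (shiftPencil K m (m + e) e)).2
    simp only [hfix, hP, hQ, pencilPoint_smul] at h1
    rw [eval_smul_of_isHomogeneous hD] at h1
    rw [pow_add, pow_mul, pow_mul]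
    exact (mul_right_cancel₀ hne h1).symm
  have hexp : a * (D / m) + (e - 1 + b) * (D / (m + e)) = D := by
    have : (Polynomial.X : Polynomial K) ^ (a * (D / m) + (e - 1 + b) * (D / (m + e)) + 1) =
        Polynomial.X ^ (D + 1) := Polynomial.funext fun t => by
      rcases eq_or_ne t 0 with rfl | ht
      · simp
      · rw [Polynomial.eval_pow, Polynomial.eval_pow, Polynomial.eval_X, pow_succ, pow_succ,
          hrel t ht]
    simpa using congrArg Polynomial.natDegree this
  obtain ⟨⟨x, hx⟩, ⟨y, hy⟩⟩ := (eval_mul_eq_of_isHomogeneous hm (by omega) hf hD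
    (by simp : (1 : Matrix _ _ K).det ≠ 0) (by simp : (1 : Matrix _ _ K).det ≠ 0)
    (shiftPencil K m (m + e) e)).1 hne
  have hy0 : y ≠ 0 := by rintro rfl; exact hD0 (by simpa using hy)
  -- comparing exponents gives `a x = (a + 1) y`, whence `m = a e`
  have h1 : D / m = x := by rw [hx, Nat.mul_div_cancel_left _ hm]
  have h2 : D / (m + e) = y := by rw [hy, Nat.mul_div_cancel_left _ (by omega)]
  rw [h1, h2] at hexp
  refine hdvd ⟨a, ?_⟩
  obtain ⟨e', rfl⟩ := Nat.exists_eq_succ_of_ne_zero he.ne'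
  have h3 : m * x = (m + (e' + 1)) * y := hx ▸ hy
  have h4 : a * x + (e' + b) * y = (m + (e' + 1)) * y := by
    rw [← hy]; simpa using hexp
  zify at h3 h4 hab ⊢
  have hy0' : (y : ℤ) ≠ 0 := by exact_mod_cast hy0
  apply mul_right_cancel₀ hy0'
  rw [← hab] at h3 h4 ⊢
  linear_combination (a : ℤ) * h3 - ((a : ℤ) + b) * h4

theorem invariants_le_of_homogeneous {m n : ℕ} {S : Subalgebra K (TensorRing m n K)}
    (h : ∀ f ∈ invariants m n K, ∀ D, f.IsHomogeneous D → D ≠ 0 → f ∈ S) :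
    invariants m n K ≤ S := by
  intro f hf
  rw [← sum_homogeneousComponent f]
  refine sum_mem fun D _ => ?_
  rcases eq_or_ne D 0 with rfl | hD
  · rw [homogeneousComponent_zero]
    exact S.algebraMap_mem _
  · exact h _ (homogeneousComponent_mem_invariants hf D) D (homogeneousComponent_isHomogeneous D f) hD

theorem invariants_eq_bot [Infinite K] {m e : ℕ} (hm : 0 < m) (he : 0 < e) (hdvd : ¬ e ∣ m) :
    invariants m (m + e) K = ⊥ := by
  refine le_bot_iff.mp (invariants_le_of_homogeneous fun f hf D hD hD0 => ?_)
  rw [eq_zero_of_eval_shiftPencil_orbit m e he f fun P Q hP hQ => ?_]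
  · exact zero_mem _
  · rw [(eval_mul_eq_of_isHomogeneous hm (by omega) hf hD hP hQ _).2,
      eval_shiftPencil_eq_zero hm he hdvd hf hD0 hD, mul_zero]

/-- In the balanced case a homogeneous invariant and a suitable multiple of a power of the block
determinant are relative invariants with the same weights that agree at the generic pencil, hence
on its dense orbit. -/
theorem invariants_eq_adjoin_blockDet [Infinite K] {m d : ℕ} (hm : 0 < m) (hd : 0 < d)
    (hdvd : d ∣ m) :
    invariants m (m + d) K = Algebra.adjoin K {blockDet m (m + d) K} := by
  obtain ⟨s, hs⟩ := hdvd
  rw [mul_comm] at hs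
  have hg : Nat.gcd m (m + d) = d := by simp [hs]
  have h0 := eval_blockDet_shiftPencil_ne_zero (K := K) m d s hd hs
  refine le_antisymm (invariants_le_of_homogeneous fun f hf D hD _ => ?_) ?_
  · set x := pencilPoint (shiftPencil K m (m + d) d) with hx
    have hrel := fun P Q hP hQ => eval_mul_eq_of_isHomogeneous hm (by omega) hf hD (P := P) (Q := Q)
      hP hQ (shiftPencil K m (m + d) d)
    by_cases hne : eval x f = 0
    · rw [eq_zero_of_eval_shiftPencil_orbit m d hd f fun P Q hP hQ => by
        rw [(hrel P Q hP hQ).2, hne, mul_zero]]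
      exact zero_mem _
    · obtain ⟨h1, h2⟩ := (hrel 1 1 (by simp) (by simp)).1 hne
      -- `D` is a multiple of `lcm (m, n)`, so `f` has the weights of a power of `Δ`
      obtain ⟨r, hr⟩ := Nat.lcm_dvd h1 h2
      have hlcm1 : m.lcm (m + d) = m * ((m + d) / d) := by
        rw [Nat.lcm, hg, Nat.mul_div_assoc]
        simp [hs]
      have hlcm2 : m.lcm (m + d) = (m + d) * (m / d) := by
        rw [Nat.lcm, hg, mul_comm, Nat.mul_div_assoc]
        simp [hs]
      have hDm : D / m = (m + d) / d * r := by
        rw [hr, hlcm1, mul_assoc, Nat.mul_div_cancel_left _ hm]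
      have hDn : D / (m + d) = m / d * r := by
        rw [hr, hlcm2, mul_assoc, Nat.mul_div_cancel_left _ (by omega)]
      have hfe : f - C (eval x f / eval x (blockDet m (m + d) K) ^ r) *
          blockDet m (m + d) K ^ r = 0 := by
        refine eq_zero_of_eval_shiftPencil_orbit m d hd _ fun P Q hP hQ => ?_
        rw [map_sub, map_mul, map_pow, eval_C, eval_blockDet_mul, (hrel P Q hP hQ).2, hDm, hDn,
          hg, ← hx]
        field_simp
        ring
      rw [sub_eq_zero.mp hfe]
      exact mul_mem (Subalgebra.algebraMap_mem _ _)
        (pow_mem (Algebra.subset_adjoin (Set.mem_singleton _)) r)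
  · rw [Algebra.adjoin_le_iff, Set.singleton_subset_iff]
    exact blockDet_mem_invariants m (m + d)

/-! ### Sagbi bases of subalgebras with one generator -/

/-- The leading exponents of the polynomials in `g` are the multiples of that of `g`, since nonzero
constants have the least degree. -/
theorem exists_degree_aeval_eq_nsmul {σ : Type*} (ord : MonomialOrder σ) (g : MvPolynomial σ K)
    (p : Polynomial K) : ∃ r : ℕ, ord.degree (Polynomial.aeval g p) = r • ord.degree g := by
  induction p using Polynomial.recOnHorner with
  | M0 => exact ⟨0, by simp⟩
  | MC p a _ _ ih =>
    obtain ⟨r, hr⟩ := ih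
    rw [map_add, Polynomial.aeval_C, MvPolynomial.algebraMap_eq]
    by_cases h : ord.degree (Polynomial.aeval g p) = 0
    · refine ⟨0, ?_⟩
      rw [ord.eq_C_of_degree_eq_zero h, ← C_add, ord.degree_C, zero_smul]
    · refine ⟨r, ?_⟩
      rw [MonomialOrder.degree_add_of_lt, hr]
      rw [ord.degree_C, map_zero]
      exact ord.toSyn_lt_iff_ne_zero.mpr (by simpa using h)
  | MX p _ ih =>
    obtain ⟨r, hr⟩ := ih
    rw [map_mul, Polynomial.aeval_X]
    by_cases h : Polynomial.aeval g p * g = 0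
    · exact ⟨0, by simp [h]⟩
    · exact ⟨r + 1, by rw [ord.degree_mul' h, hr, succ_nsmul]⟩

theorem isSagbiBasis_singleton {σ : Type*} (ord : MonomialOrder σ) {g : MvPolynomial σ K}
    (hg : g ≠ 0) : IsSagbiBasis ord (Algebra.adjoin K {g}) {g} := by
  refine ⟨Algebra.subset_adjoin, le_antisymm ?_ ?_⟩
  · exact Algebra.adjoin_mono (Set.image_mono fun f hf => ⟨Algebra.subset_adjoin hf.1, hf.2⟩)
  · rw [initialAlgebra, Algebra.adjoin_le_iff]
    rintro _ ⟨f, ⟨hf, -⟩, rfl⟩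
    rw [Algebra.adjoin_singleton_eq_range_aeval] at hf
    obtain ⟨p, rfl⟩ := hf
    obtain ⟨r, hr⟩ := exists_degree_aeval_eq_nsmul ord g p
    have : leadingMonomial ord (Polynomial.aeval g p) = leadingMonomial ord g ^ r := by
      rw [leadingMonomial, leadingMonomial, monomial_pow, one_pow, hr]
    change leadingMonomial ord (Polynomial.aeval g p) ∈ _
    rw [this]
    have hmem : g ∈ {f | f ∈ ({g} : Set (MvPolynomial σ K)) ∧ f ≠ 0} := ⟨rfl, hg⟩
    exact pow_mem (Algebra.subset_adjoin (Set.mem_image_of_mem _ hmem)) r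

end TensorInvariants

end

theorem mainTheorem2 {K : Type*} [Field K] [Infinite K] (m n : ℕ) (hm : 0 < m) (hmn : m < n) :
    (n = m + Nat.gcd m n →
      TensorInvariants.IsSagbiBasis (TensorInvariants.tensorOrder m n)
        (TensorInvariants.invariants m n K) {TensorInvariants.blockDet m n K} ∧
      TensorInvariants.invariants m n K =
        Algebra.adjoin K {TensorInvariants.blockDet m n K}) ∧
    (n ≠ m + Nat.gcd m n → TensorInvariants.invariants m n K = ⊥) := by
  obtain ⟨e, rfl⟩ := Nat.exists_eq_add_of_lt hmn
  rw [add_assoc]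
  have he : 0 < e + 1 := Nat.succ_pos e
  generalize e + 1 = d at *
  rw [Nat.gcd_self_add_right, add_right_inj]
  refine ⟨fun h => ?_, fun h => ?_⟩
  · have hdvd : d ∣ m := h ▸ Nat.gcd_dvd_left m d
    have hΔ : TensorInvariants.blockDet m (m + d) K ≠ 0 := fun h0 => by
      obtain ⟨s, hs⟩ := hdvd
      have := TensorInvariants.eval_blockDet_shiftPencil_ne_zero (K := K) m d s he
        (by rw [hs, mul_comm])
      rw [h0, map_zero] at this
      exact this rfl
    have hinv := TensorInvariants.invariants_eq_adjoin_blockDet (K := K) hm he hdvd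
    refine ⟨?_, hinv⟩
    rw [hinv]
    exact TensorInvariants.isSagbiBasis_singleton _ hΔ
  · exact TensorInvariants.invariants_eq_bot hm he fun hdvd =>
      h (by rw [Nat.gcd_eq_right hdvd])
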